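/- Let $\mathbb{R}^2_+=\{(x_1,x_2): x_2>0\}$. For $R>0$ and $x\in\mathbb{R}^2$ let $Q_R(x)=x+[-\tfrac R2,\tfrac R2]^2$, and for a function $v\ge 0$ on $\overline{\mathbb{R}^2_+}$ put $$\delta_v(R)=\sup_{Q_R(x)\subseteq\overline{\mathbb{R}^2_+}}\ \frac{1}{|Q_R(x)|}\int_{Q_R(x)}e^{-2v}\,dy .$$ Let $0<\bar\lambda\le\bar\Lambda$ and $\bar\kappa\ge 0$. Then there is an odd integer $N\ge 3$, depending only on $(\bar\lambda,\bar\Lambda,\bar\kappa)$, with the following property. Let $\bar K$ be a measurable function on $\mathbb{R}^2_+$ with $\bar\lambda\le\bar K\le\bar\Lambda$, and let $v:\overline{\mathbb{R}^2_+}\to[0,\infty)$ be $C^1$ up to the boundary and satisfy $$\Delta v=\bar K e^{-2v}\ \text{ in } \mathbb{R}^2_+ \text{ in the sense of distributions},\qquad \Big|\frac{\partial v}{\partial x_2}(x_1,0)\Big|\le\bar\kappa\ \text{ for all } x_1\in\mathbb{R}.$$ Then for every integer $k\ge 0$, $$\delta_v(N^k)\le\Big(1-\frac{1}{2N^2}\Big)^k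 .$$ -/

import Mathlib

open MeasureTheory Set
open scoped ENNReal ContDiff

noncomputable section

/-- The Euclidean plane; the coordinates `x₁, x₂` of a point are `x 0, x 1`. -/
abbrev Plane : Type := EuclideanSpace ℝ (Fin 2)

/-- The open half plane `{x₂ > 0}`. -/
def openHalfPlane : Set Plane := {x | 0 < x 1}

/-- The closed half plane `{x₂ ≥ 0}`. -/
def closedHalfPlane : Set Plane := {x | 0 ≤ x 1}

/-- The closed square `Q_R(x) = x + [-R/2, R/2]²`. -/
def square (R : ℝ) (x : Plane) : Set Plane := {y | ∀ i, |y i - x i| ≤ R / 2}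

/-- The density `|Ω|⁻¹ ∫_Ω e^{-2v}`, as an element of `[0, ∞]`. -/
def density (v : Plane → ℝ) (Ω : Set Plane) : ℝ≥0∞ :=
  (∫⁻ x in Ω, ENNReal.ofReal (Real.exp (-2 * v x))) / volume Ω

/-- The global density at scale `R`: the supremum in `[0, ∞]` of the densities over all squares of
side `R` contained in the closed half plane. -/
def globalDensity (v : Plane → ℝ) (R : ℝ) : ℝ≥0∞ :=
  ⨆ (x : Plane) (_ : square R x ⊆ closedHalfPlane), density v (square R x)

/-- `Δ v = f` in the sense of distributions in the open half plane. -/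
def HasDistribLaplacian (v f : Plane → ℝ) : Prop :=
  ∀ φ : Plane → ℝ, ContDiff ℝ ∞ φ → HasCompactSupport φ → tsupport φ ⊆ openHalfPlane →
    ∫ x in openHalfPlane, v x * Laplacian.laplacian φ x = ∫ x in openHalfPlane, f x * φ x

/-- The one-sided normal derivative `∂v/∂x₂ (s, 0)` at a boundary point of the half plane. -/
def boundaryNormalDeriv (v : Plane → ℝ) (s : ℝ) : ℝ :=
  derivWithin (fun t : ℝ => v !₂[s, t]) (Ici 0) 0

/-- `v ≥ 0` solves `Δ v = K e^{-2v}` in the half plane with `K` measurable and `lam ≤ K ≤ Lam`, and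
`|∂v/∂x₂| ≤ kap` on the boundary. Here `v` is `C¹` up to the boundary, so that the normal derivative
is a genuine one, and the equation holds in the sense of distributions, `K` being only measurable.
Values of `v` and `K` outside the closed half plane are irrelevant. -/
structure IsPinchedSolution (lam Lam kap : ℝ) (K v : Plane → ℝ) : Prop where
  measurable_K : Measurable K
  pinched : ∀ x ∈ openHalfPlane, lam ≤ K x ∧ K x ≤ Lam
  contDiffOn : ContDiffOn ℝ 1 v closedHalfPlane
  nonneg : ∀ x ∈ openHalfPlane, 0 ≤ v x
  equation : HasDistribLaplacian v (fun x => K x * Real.exp (-2 * v x))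
  boundary : ∀ s : ℝ, |boundaryNormalDeriv v s| ≤ kap

end

/-!
The density of `e^{-2v}` decays by a fixed factor whenever the side of the squares is multiplied
by a large odd `N = 2p + 7`. Put `θ = 1 - 1 / (2 N²)`, `R = N ^ k`, `d = θ ^ k`, and assume that the
densities at the scales `N ^ j`, `j ≤ k`, are at most `θ ^ j`.

Suppose that some square `Q` of side `N R` in the closed half plane has density above `θ ^ (k + 1)`.
Among the `N²` cells of side `R` of `Q` each has density at most `d`, so each has density above
`d / 2` (`half_lt_expMass_cell`), for otherwise the average over `Q` would be too small. Two
consequences contradict each other when `N` is large.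

* `v` is small: every cell contains a point `z` with `v z ≤ 1 / d ≤ d R²`. The weighted means of `v`
  around `z` grow in the scale `t` at the rate `t⁻¹ ∫ Δv χ(‖y - z‖² / t²)`, hence at most like the
  mass of `e^{-2v}` in a square of side `2 t` divided by `t`. As the densities are controlled at *all*
  scales below `R`, this mass is at most a constant times `t d R` (`expMass_square_le_linear`), so
  no logarithm of `d` is lost, and the integral of `v` over the cell is at most a constant times
  `d R⁴` (`integral_square_le`).
* `v` is large: the equation tested against one cutoff at scale `p R` around the centre of `Q`
  bounds the integral of `v` over the disc of radius `p R` below by a constant times `p⁴ d R⁴`, whereas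
  summing the first estimate over the cells gives at most a constant times `N² d R⁴`
  (`expMass_square_pow_succ_le`).

Only cells away from the edge of the half plane enter, so every disc that is used lies in its
interior.
-/

/-! ### A smooth radial cutoff -/

/-- The profile `χ` of the radial cutoffs `y ↦ χ (‖y - z‖² / t²)`: smooth, strictly decreasing
on `(-∞, 1]`, and zero on `[1, ∞)`. -/
noncomputable def cutoffProfile (s : ℝ) : ℝ := expNegInvGlue (1 - s)

lemma contDiff_cutoffProfile : ContDiff ℝ ∞ cutoffProfile :=
  expNegInvGlue.contDiff.comp (contDiff_const.sub contDiff_id)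

lemma cutoffProfile_eq_zero {s : ℝ} (hs : 1 ≤ s) : cutoffProfile s = 0 :=
  expNegInvGlue.zero_of_nonpos (by linarith)

lemma cutoffProfile_nonneg (s : ℝ) : 0 ≤ cutoffProfile s := expNegInvGlue.nonneg _

lemma cutoffProfile_le_one (s : ℝ) : cutoffProfile s ≤ 1 := by
  unfold cutoffProfile expNegInvGlue
  split_ifs with h
  · norm_num
  · push Not at h
    exact Real.exp_le_one_iff.2 (neg_nonpos.2 (inv_nonneg.2 h.le))

lemma hasDerivAt_cutoffProfile (s : ℝ) :
    HasDerivAt cutoffProfile (-((1 - s)⁻¹ ^ 2 * expNegInvGlue (1 - s))) s := by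
  have h := expNegInvGlue.hasDerivAt_polynomial_eval_inv_mul 1 (1 - s)
  simp only [Polynomial.eval_one, one_mul, Polynomial.derivative_one, sub_zero, mul_one,
    Polynomial.eval_pow, Polynomial.eval_X] at h
  have h2 : HasDerivAt (fun s : ℝ => 1 - s) (-1) s := by
    simpa using (hasDerivAt_id s).const_sub 1
  refine (h.comp s h2).congr_deriv ?_
  ring

lemma deriv_cutoffProfile_nonpos (s : ℝ) : deriv cutoffProfile s ≤ 0 := by
  rw [(hasDerivAt_cutoffProfile s).deriv]
  have := expNegInvGlue.nonneg (1 - s)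
  exact neg_nonpos.2 (by positivity)

lemma deriv_cutoffProfile_neg {s : ℝ} (hs : s < 1) : deriv cutoffProfile s < 0 := by
  rw [(hasDerivAt_cutoffProfile s).deriv]
  have := expNegInvGlue.pos_of_pos (sub_pos.2 hs)
  have h : 0 < 1 - s := sub_pos.2 hs
  exact neg_neg_of_pos (by positivity)

lemma deriv_cutoffProfile_eq_zero {s : ℝ} (hs : 1 ≤ s) : deriv cutoffProfile s = 0 := by
  rw [(hasDerivAt_cutoffProfile s).deriv,
    expNegInvGlue.zero_of_nonpos (by linarith : 1 - s ≤ 0)]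
  simp

lemma contDiff_deriv_cutoffProfile : ContDiff ℝ ∞ (deriv cutoffProfile) :=
  (contDiff_infty_iff_deriv.1 contDiff_cutoffProfile).2

lemma deriv_deriv_cutoffProfile_eq_zero {s : ℝ} (hs : 1 ≤ s) :
    deriv (deriv cutoffProfile) s = 0 := by
  have h := (contDiff_deriv_cutoffProfile.differentiable (by simp) s).hasDerivAt
  have h1 : HasDerivWithinAt (deriv cutoffProfile) 0 (Ici s) s :=
    (hasDerivWithinAt_const s (Ici s) (0 : ℝ)).congr
      (fun x hx => deriv_cutoffProfile_eq_zero (hs.trans hx)) (deriv_cutoffProfile_eq_zero hs)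
  exact (uniqueDiffWithinAt_Ici s).eq_deriv _ h.hasDerivWithinAt h1

/-- The Laplacian in the plane of `y ↦ χ (‖y‖²)`, as a function of `s = ‖y‖²`. -/
noncomputable def cutoffLaplacian (s : ℝ) : ℝ :=
  4 * deriv cutoffProfile s + 4 * s * deriv (deriv cutoffProfile) s

lemma cutoffLaplacian_eq_zero {s : ℝ} (hs : 1 ≤ s) : cutoffLaplacian s = 0 := by
  simp [cutoffLaplacian, deriv_cutoffProfile_eq_zero hs, deriv_deriv_cutoffProfile_eq_zero hs]

lemma continuous_cutoffLaplacian : Continuous cutoffLaplacian := by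
  have h1 := contDiff_deriv_cutoffProfile.continuous
  have h2 : Continuous (deriv (deriv cutoffProfile)) :=
    contDiff_deriv_cutoffProfile.continuous_deriv (by simp)
  unfold cutoffLaplacian
  fun_prop

lemma exists_bound_of_vanishing {g : ℝ → ℝ} (hg : Continuous g) (h0 : ∀ s, 1 ≤ s → g s = 0) :
    ∃ B : ℝ, 0 < B ∧ ∀ s, 0 ≤ s → |g s| ≤ B := by
  obtain ⟨B, hB⟩ := (isCompact_Icc (a := (0 : ℝ)) (b := 1)).exists_bound_of_continuousOn
    hg.continuousOn
  refine ⟨max B 1, by positivity, fun s hs => ?_⟩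
  rcases le_total s 1 with h | h
  · exact (hB s ⟨hs, h⟩).trans (le_max_left _ _)
  · rw [h0 s h, abs_zero]; positivity

lemma exists_cutoff_lower_bound :
    ∃ c : ℝ, 0 < c ∧ ∀ s, 0 ≤ s → s ≤ 1 / 2 → c ≤ cutoffProfile s ∧ c ≤ -deriv cutoffProfile s := by
  have hc : ContinuousOn (fun s => min (cutoffProfile s) (-deriv cutoffProfile s))
      (Icc (0 : ℝ) (1 / 2)) := by
    have h1 := contDiff_deriv_cutoffProfile.continuous
    have h2 := contDiff_cutoffProfile.continuous
    fun_prop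
  obtain ⟨x, hx, hmin⟩ := isCompact_Icc.exists_isMinOn (nonempty_Icc.2 (by norm_num)) hc
  have hx1 : x < 1 := lt_of_le_of_lt hx.2 (by norm_num)
  refine ⟨_, lt_min (expNegInvGlue.pos_of_pos (sub_pos.2 hx1))
    (neg_pos.2 (deriv_cutoffProfile_neg hx1)), fun s h0 h1 => ?_⟩
  exact le_min_iff.1 (hmin ⟨h0, h1⟩)

/-! ### The equation tested against radial cutoffs -/

lemma contDiff_radial_cutoff (z : Plane) (t : ℝ) :
    ContDiff ℝ ∞ (fun y : Plane => cutoffProfile (‖y - z‖ ^ 2 / t ^ 2)) :=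
  contDiff_cutoffProfile.comp (((contDiff_id.sub contDiff_const).norm_sq ℝ).div_const _)

lemma hasFDerivAt_radial {g : ℝ → ℝ} (hg : Differentiable ℝ g) (z : Plane) (t : ℝ) (y : Plane) :
    HasFDerivAt (fun y : Plane => g (‖y - z‖ ^ 2 / t ^ 2))
      ((2 / t ^ 2 * deriv g (‖y - z‖ ^ 2 / t ^ 2)) • innerSL ℝ (y - z)) y := by
  have h1 : HasFDerivAt (fun y : Plane => ‖y - z‖ ^ 2) (2 • innerSL ℝ (y - z)) y := by
    simpa using ((hasFDerivAt_id y).sub_const z).norm_sq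
  have h2 : HasFDerivAt (fun y : Plane => ‖y - z‖ ^ 2 / t ^ 2)
      ((t ^ 2)⁻¹ • (2 • innerSL ℝ (y - z))) y := by
    simpa [div_eq_mul_inv] using h1.mul_const ((t ^ 2)⁻¹)
  have h3 := (hg (‖y - z‖ ^ 2 / t ^ 2)).hasDerivAt.comp_hasFDerivAt y h2
  refine h3.congr_fderiv ?_
  ext w
  simp
  ring

lemma laplacian_radial_cutoff (z : Plane) {t : ℝ} (ht : 0 < t) (y : Plane) :
    Laplacian.laplacian (fun y : Plane => cutoffProfile (‖y - z‖ ^ 2 / t ^ 2)) y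
      = cutoffLaplacian (‖y - z‖ ^ 2 / t ^ 2) / t ^ 2 := by
  rw [InnerProductSpace.laplacian_eq_iteratedFDeriv_orthonormalBasis _
    (EuclideanSpace.basisFun (Fin 2) ℝ)]
  have hd1 : Differentiable ℝ cutoffProfile := contDiff_cutoffProfile.differentiable (by simp)
  have hd2 : Differentiable ℝ (deriv cutoffProfile) :=
    contDiff_deriv_cutoffProfile.differentiable (by simp)
  have hf : fderiv ℝ (fun y : Plane => cutoffProfile (‖y - z‖ ^ 2 / t ^ 2)) = fun y =>
      (2 / t ^ 2 * deriv cutoffProfile (‖y - z‖ ^ 2 / t ^ 2)) • innerSL ℝ (y - z) :=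
    funext fun y => (hasFDerivAt_radial hd1 z t y).fderiv
  have hi : HasFDerivAt (fun y : Plane => innerSL ℝ (y - z)) (innerSL ℝ (E := Plane)) y :=
    (innerSL ℝ (E := Plane)).hasFDerivAt.comp y ((hasFDerivAt_id y).sub_const z)
  have hff : fderiv ℝ (fun y : Plane =>
      (2 / t ^ 2 * deriv cutoffProfile (‖y - z‖ ^ 2 / t ^ 2)) • innerSL ℝ (y - z)) y = _ :=
    (((hasFDerivAt_radial hd2 z t y).const_mul (2 / t ^ 2)).smul hi).fderiv
  have key : ∀ e : Plane, iteratedFDeriv ℝ 2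
      (fun y : Plane => cutoffProfile (‖y - z‖ ^ 2 / t ^ 2)) y ![e, e] =
      (2 / t ^ 2) ^ 2 * deriv (deriv cutoffProfile) (‖y - z‖ ^ 2 / t ^ 2) * (inner ℝ (y - z) e) ^ 2
        + 2 / t ^ 2 * deriv cutoffProfile (‖y - z‖ ^ 2 / t ^ 2) * inner ℝ e e := by
    intro e
    rw [iteratedFDeriv_two_apply, hf, hff]
    have hee : (innerSL ℝ e) e = inner ℝ e e := rfl
    have hye : (innerSL ℝ (y - z)) e = inner ℝ (y - z) e := rfl
    simp only [add_apply, smul_apply,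
      ContinuousLinearMap.smulRight_apply, Matrix.cons_val_zero, Matrix.cons_val_one, hee, hye,
      smul_eq_mul]
    ring
  simp only [key, Fin.sum_univ_two]
  have hn : ‖y - z‖ ^ 2 = (y 0 - z 0) ^ 2 + (y 1 - z 1) ^ 2 := by
    rw [EuclideanSpace.real_norm_sq_eq, Fin.sum_univ_two]; rfl
  unfold cutoffLaplacian
  simp [EuclideanSpace.inner_single_right]
  rw [hn]
  field_simp
  ring

lemma one_le_sq_div_of_le_norm_sub {y z : Plane} {t : ℝ} (ht : 0 < t) (h : t ≤ ‖y - z‖) :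
    1 ≤ ‖y - z‖ ^ 2 / t ^ 2 := by
  rw [one_le_div (by positivity)]
  gcongr

lemma closedBall_subset_openHalfPlane {z : Plane} {t : ℝ} (hz : t < z 1) :
    Metric.closedBall z t ⊆ openHalfPlane := by
  intro y hy
  have h1 : |(y - z) 1| ≤ ‖y - z‖ := by
    simpa using PiLp.norm_apply_le (y - z) 1
  rw [Metric.mem_closedBall, dist_eq_norm] at hy
  have h2 := (abs_le.1 (h1.trans hy)).1
  simp only [PiLp.sub_apply] at h2
  change 0 < y 1
  linarith

/-- The equation tested against the cutoff of radius `t` centred at `z`, whose support is a disc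
inside the open half plane. -/
lemma HasDistribLaplacian.integral_cutoff {v f : Plane → ℝ} (h : HasDistribLaplacian v f)
    {z : Plane} {t : ℝ} (ht : 0 < t) (hz : t < z 1) :
    ∫ y in openHalfPlane, v y * (cutoffLaplacian (‖y - z‖ ^ 2 / t ^ 2) / t ^ 2)
      = ∫ y in openHalfPlane, f y * cutoffProfile (‖y - z‖ ^ 2 / t ^ 2) := by
  have hs : Function.support (fun y : Plane => cutoffProfile (‖y - z‖ ^ 2 / t ^ 2)) ⊆
      Metric.closedBall z t := by
    intro y hy
    by_contra hn
    rw [Metric.mem_closedBall, dist_eq_norm, not_le] at hn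
    exact hy (cutoffProfile_eq_zero (one_le_sq_div_of_le_norm_sub ht hn.le))
  have hts := closure_minimal hs Metric.isClosed_closedBall
  have := h _ (contDiff_radial_cutoff z t)
    ((isCompact_closedBall z t).of_isClosed_subset (isClosed_tsupport _) hts)
    (hts.trans (closedBall_subset_openHalfPlane hz))
  simpa only [laplacian_radial_cutoff z ht] using this

/-! ### Squares, grids and densities -/

lemma square_eq_preimage (R : ℝ) (x : Plane) :
    square R x = (WithLp.ofLp : Plane → Fin 2 → ℝ) ⁻¹'
      Icc (fun i => x i - R / 2) (fun i => x i + R / 2) := by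
  ext y
  simp only [square, mem_ofPred_eq, mem_preimage, mem_Icc, Pi.le_def, ← forall_and, abs_le]
  exact forall_congr' fun i => ⟨fun h => ⟨by linarith, by linarith⟩,
    fun h => ⟨by linarith, by linarith⟩⟩

lemma isCompact_square (R : ℝ) (x : Plane) : IsCompact (square R x) := by
  rw [square_eq_preimage]
  exact (PiLp.homeomorph 2 (fun _ : Fin 2 => ℝ)).isCompact_preimage.2 isCompact_Icc

lemma volume_square {R : ℝ} (hR : 0 ≤ R) (x : Plane) :
    volume (square R x) = ENNReal.ofReal (R ^ 2) := by
  rw [square_eq_preimage, (PiLp.volume_preserving_ofLp (Fin 2)).measure_preimage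
    measurableSet_Icc.nullMeasurableSet, Real.volume_Icc_pi]
  simp only [Fin.prod_univ_two]
  rw [← ENNReal.ofReal_mul (by linarith)]
  congr 1
  ring

lemma volume_real_square {R : ℝ} (hR : 0 ≤ R) (x : Plane) :
    volume.real (square R x) = R ^ 2 := by
  rw [measureReal_def, volume_square hR, ENNReal.toReal_ofReal (by positivity)]

lemma square_subset_closedHalfPlane {R : ℝ} {x : Plane} (h : R / 2 ≤ x 1) :
    square R x ⊆ closedHalfPlane := by
  intro y hy
  have := (abs_le.1 (hy 1)).1
  change 0 ≤ y 1
  linarith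

lemma half_le_of_square_subset {R : ℝ} (hR : 0 ≤ R) {x : Plane}
    (h : square R x ⊆ closedHalfPlane) : R / 2 ≤ x 1 := by
  have hy : (!₂[x 0, x 1 - R / 2] : Plane) ∈ square R x := by
    intro i
    fin_cases i
    · simp; positivity
    · simp [abs_of_nonneg (by positivity : 0 ≤ R / 2)]
  have : 0 ≤ x 1 - R / 2 := h hy
  linarith

/-- The centre of the cell `p`, counted from the lower left, in the subdivision of the square of
side `n * r` centred at `x` into `n ^ 2` squares of side `r`. -/
noncomputable def cellCenter (n : ℕ) (r : ℝ) (x : Plane) (p : ℕ × ℕ) : Plane :=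
  !₂[x 0 + (p.1 - (n - 1) / 2) * r, x 1 + (p.2 - (n - 1) / 2) * r]

@[simp] lemma cellCenter_zero (n : ℕ) (r : ℝ) (x : Plane) (p : ℕ × ℕ) :
    cellCenter n r x p 0 = x 0 + (p.1 - (n - 1) / 2) * r := rfl

@[simp] lemma cellCenter_one (n : ℕ) (r : ℝ) (x : Plane) (p : ℕ × ℕ) :
    cellCenter n r x p 1 = x 1 + (p.2 - (n - 1) / 2) * r := rfl

lemma exists_cell_coordinate {n : ℕ} {r : ℝ} (hr : 0 < r) (hn : 0 < n) {u : ℝ}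
    (hu : |u| ≤ n * r / 2) : ∃ i < n, |u - (i - (n - 1) / 2) * r| ≤ r / 2 := by
  obtain ⟨h1, h2⟩ := abs_le.1 hu
  have hw : 0 ≤ (u + n * r / 2) / r := div_nonneg (by linarith) hr.le
  -- the right endpoint belongs to the last cell
  refine ⟨min ⌊(u + n * r / 2) / r⌋₊ (n - 1), by omega, ?_⟩
  rcases le_total ⌊(u + n * r / 2) / r⌋₊ (n - 1) with h | h
  · rw [min_eq_left h]
    have h3 := Nat.floor_le hw
    have h4 := Nat.lt_floor_add_one ((u + n * r / 2) / r)
    rw [le_div_iff₀ hr] at h3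
    rw [div_lt_iff₀ hr] at h4
    rw [abs_le]
    constructor <;> linarith
  · rw [min_eq_right h, Nat.cast_sub (by omega), Nat.cast_one]
    have h3 := (Nat.le_floor_iff hw).1 h
    rw [le_div_iff₀ hr, Nat.cast_sub (by omega), Nat.cast_one] at h3
    rw [abs_le]
    constructor <;> linarith

lemma exists_cell {n : ℕ} {r : ℝ} (hr : 0 < r) (hn : 0 < n) {x y : Plane}
    (hy : y ∈ square (n * r) x) :
    ∃ p ∈ Finset.range n ×ˢ Finset.range n, y ∈ square r (cellCenter n r x p) := by
  obtain ⟨i, hi, hi'⟩ := exists_cell_coordinate hr hn (hy 0)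
  obtain ⟨j, hj, hj'⟩ := exists_cell_coordinate hr hn (hy 1)
  refine ⟨(i, j), by simp [hi, hj], fun k => ?_⟩
  fin_cases k
  · simpa [← sub_sub] using hi'
  · simpa [← sub_sub] using hj'

lemma cell_subset_closedHalfPlane {n : ℕ} {r : ℝ} (hr : 0 ≤ r) {x : Plane}
    (hx : n * r / 2 ≤ x 1) (p : ℕ × ℕ) : square r (cellCenter n r x p) ⊆ closedHalfPlane := by
  apply square_subset_closedHalfPlane
  rw [cellCenter_one]
  have : 0 ≤ (p.2 : ℝ) * r := by positivity
  linarith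

/-- Subadditivity of the integral of a nonnegative function over a finite, possibly overlapping,
cover. -/
lemma setIntegral_le_sum_of_subset_biUnion {α ι : Type*} [MeasurableSpace α] {μ : Measure α}
    {g : α → ℝ} {A : Set α} {s : Finset ι} {S : ι → Set α} (hA : MeasurableSet A)
    (hS : ∀ i ∈ s, MeasurableSet (S i)) (hg : ∀ i ∈ s, IntegrableOn g (S i) μ)
    (hg0 : ∀ i ∈ s, ∀ y ∈ S i, 0 ≤ g y) (hAS : ∀ y ∈ A, ∃ i ∈ s, y ∈ S i) :
    ∫ y in A, g y ∂μ ≤ ∑ i ∈ s, ∫ y in S i, g y ∂μ := by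
  have hU : IntegrableOn g (⋃ i ∈ s, S i) μ := integrableOn_finset_iUnion.2 hg
  have hAU : A ⊆ ⋃ i ∈ s, S i := fun y hy => by simpa using hAS y hy
  have hnn : ∀ i ∈ s, ∀ y, 0 ≤ (S i).indicator g y := fun i hi y =>
    indicator_nonneg (hg0 i hi) y
  calc ∫ y in A, g y ∂μ = ∫ y, A.indicator g y ∂μ := (integral_indicator hA).symm
    _ ≤ ∫ y, ∑ i ∈ s, (S i).indicator g y ∂μ := by
        refine integral_mono ((hU.mono_set hAU).integrable_indicator hA)
          (integrable_finsetSum _ fun i hi => (hg i hi).integrable_indicator (hS i hi))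
          fun y => ?_
        by_cases hy : y ∈ A
        · obtain ⟨i, hi, hyi⟩ := hAS y hy
          rw [indicator_of_mem hy, ← indicator_of_mem hyi g]
          exact Finset.single_le_sum (f := fun i => (S i).indicator g y)
            (fun j hj => hnn j hj y) hi
        · rw [indicator_of_notMem hy]
          exact Finset.sum_nonneg fun j hj => hnn j hj y
    _ = ∑ i ∈ s, ∫ y, (S i).indicator g y ∂μ :=
        integral_finsetSum _ fun i hi => (hg i hi).integrable_indicator (hS i hi)
    _ = ∑ i ∈ s, ∫ y in S i, g y ∂μ :=
        Finset.sum_congr rfl fun i hi => integral_indicator (hS i hi)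

/-! ### The mass of `e^{-2v}` on squares -/

/-- The mass `∫_Ω e^{-2v}`. -/
noncomputable def expMass (v : Plane → ℝ) (Ω : Set Plane) : ℝ :=
  ∫ y in Ω, Real.exp (-2 * v y)

lemma isOpen_openHalfPlane : IsOpen openHalfPlane :=
  isOpen_lt continuous_const (by fun_prop)

lemma openHalfPlane_subset : openHalfPlane ⊆ closedHalfPlane :=
  fun x hx => (le_of_lt hx : (0 : ℝ) ≤ x 1)

lemma nonneg_on_closedHalfPlane {v : Plane → ℝ} (hc : ContinuousOn v closedHalfPlane)
    (h0 : ∀ x ∈ openHalfPlane, 0 ≤ v x) : ∀ x ∈ closedHalfPlane, 0 ≤ v x := by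
  intro x hx
  have hx' : 0 ≤ x 1 := hx
  let γ : ℝ → Plane := fun t => !₂[x 0, x 1 + t]
  have hγ : Continuous γ := by
    unfold γ
    fun_prop
  have hγ0 : γ 0 = x := by
    ext i
    fin_cases i <;> simp [γ]
  have hpos : ∀ t ∈ Ioi (0 : ℝ), γ t ∈ openHalfPlane := fun t ht =>
    add_pos_of_nonneg_of_pos hx' ht
  have h1 : ContinuousWithinAt (v ∘ γ) (Ioi 0) 0 :=
    (hγ0 ▸ hc x hx : ContinuousWithinAt v closedHalfPlane (γ 0)).comp
      hγ.continuousWithinAt fun t ht => openHalfPlane_subset (hpos t ht)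
  have h2 : 0 ≤ (v ∘ γ) 0 := ge_of_tendsto h1 (by
    filter_upwards [self_mem_nhdsWithin] with t ht
    exact h0 _ (hpos t ht))
  simpa [hγ0] using h2

section
variable {v : Plane → ℝ} (hc : ContinuousOn v closedHalfPlane)
  (h0 : ∀ x ∈ closedHalfPlane, 0 ≤ v x)
include hc

lemma integrableOn_exp_square {R : ℝ} {x : Plane} (h : square R x ⊆ closedHalfPlane) :
    IntegrableOn (fun y => Real.exp (-2 * v y)) (square R x) := by
  refine ContinuousOn.integrableOn_compact (isCompact_square R x) ?_
  have := hc.mono h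
  fun_prop

lemma density_eq_ofReal {R : ℝ} (hR : 0 < R) {x : Plane} (h : square R x ⊆ closedHalfPlane) :
    density v (square R x) = ENNReal.ofReal (expMass v (square R x) / R ^ 2) := by
  rw [density, volume_square hR.le, expMass, ENNReal.ofReal_div_of_pos (by positivity),
    ofReal_integral_eq_lintegral_ofReal (integrableOn_exp_square hc h)
      (Filter.Eventually.of_forall fun y => (Real.exp_pos _).le)]

lemma globalDensity_le_iff {R d : ℝ} (hR : 0 < R) (hd : 0 ≤ d) :
    globalDensity v R ≤ ENNReal.ofReal d ↔
      ∀ x : Plane, R / 2 ≤ x 1 → expMass v (square R x) ≤ d * R ^ 2 := by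
  rw [globalDensity, iSup₂_le_iff]
  refine forall_congr' fun x => ⟨fun h hx => ?_, fun h hx => ?_⟩
  · have hs := square_subset_closedHalfPlane hx
    have := h hs
    rwa [density_eq_ofReal hc hR hs, ENNReal.ofReal_le_ofReal_iff hd,
      div_le_iff₀ (by positivity)] at this
  · have := h (half_le_of_square_subset hR.le hx)
    rwa [density_eq_ofReal hc hR hx, ENNReal.ofReal_le_ofReal_iff hd,
      div_le_iff₀ (by positivity)]

lemma expMass_square_le_sum {n : ℕ} {r : ℝ} (hr : 0 < r) (hn : 0 < n) {x : Plane}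
    (hx : n * r / 2 ≤ x 1) :
    expMass v (square (n * r) x) ≤
      ∑ p ∈ Finset.range n ×ˢ Finset.range n, expMass v (square r (cellCenter n r x p)) :=
  setIntegral_le_sum_of_subset_biUnion (isCompact_square _ _).measurableSet
    (fun _ _ => (isCompact_square _ _).measurableSet)
    (fun p _ => integrableOn_exp_square hc (cell_subset_closedHalfPlane hr.le hx p))
    (fun _ _ _ _ => (Real.exp_pos _).le) (fun _ hy => exists_cell hr hn hy)

lemma expMass_square_mono {R R' : ℝ} {x x' : Plane} (h : square R x ⊆ square R' x')
    (h' : square R' x' ⊆ closedHalfPlane) :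
    expMass v (square R x) ≤ expMass v (square R' x') :=
  setIntegral_mono_set (integrableOn_exp_square hc h')
    (Filter.Eventually.of_forall fun _ => (Real.exp_pos _).le) h.eventuallyLE

lemma expMass_square_le_of_le {R d : ℝ} (hR : 0 ≤ R) {x : Plane}
    (h : square R x ⊆ closedHalfPlane) (hd : ∀ y ∈ square R x, Real.exp (-2 * v y) ≤ d) :
    expMass v (square R x) ≤ d * R ^ 2 := by
  have := setIntegral_mono_on (integrableOn_exp_square hc h)
    (integrableOn_const (C := d) (isCompact_square R x).measure_lt_top.ne)
    (isCompact_square R x).measurableSet hd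
  rw [setIntegral_const, volume_real_square hR, smul_eq_mul, mul_comm] at this
  exact this

include h0 in
lemma expMass_square_le_sq {R : ℝ} (hR : 0 ≤ R) {x : Plane}
    (h : square R x ⊆ closedHalfPlane) : expMass v (square R x) ≤ R ^ 2 := by
  have := expMass_square_le_of_le hc hR h (d := 1) fun y hy =>
    Real.exp_le_one_iff.2 (by have := h0 y (h hy); linarith)
  simpa using this

/-- If all squares of side `r` have density at most `d`, then squares of larger side have density
at most `4 * d`. -/
lemma expMass_square_le_four_mul {r d s : ℝ} (hr : 0 < r) (hd : 0 ≤ d) (hs : r ≤ s)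
    (H : ∀ x : Plane, r / 2 ≤ x 1 → expMass v (square r x) ≤ d * r ^ 2) {x : Plane}
    (hx : s / 2 ≤ x 1) : expMass v (square s x) ≤ 4 * d * s ^ 2 := by
  set n := ⌈s / r⌉₊ with hn
  have h1 : 1 ≤ s / r := (one_le_div hr).2 hs
  have hn0 : 0 < n := Nat.ceil_pos.2 (by linarith)
  have hns : s ≤ n * r := (div_le_iff₀ hr).1 (Nat.le_ceil _)
  have hns2 : n * r ≤ 2 * s := by
    have := Nat.ceil_lt_add_one (by linarith : 0 ≤ s / r)
    have h2 : (n : ℝ) ≤ 2 * (s / r) := by rw [hn]; linarith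
    calc n * r ≤ 2 * (s / r) * r := by gcongr
      _ = 2 * s := by field_simp
  -- the square is enlarged upwards, so that it stays in the half plane
  set x' : Plane := !₂[x 0, x 1 + (n * r - s) / 2] with hx'
  have hx1 : n * r / 2 ≤ x' 1 := by
    simp [hx']
    linarith
  have hsub : square s x ⊆ square (n * r) x' := by
    intro y hy i
    have := abs_le.1 (hy i)
    rw [abs_le]
    fin_cases i
    · simp [hx'] at this ⊢
      constructor <;> linarith
    · simp [hx'] at this ⊢
      constructor <;> linarith
  calc expMass v (square s x) ≤ expMass v (square (n * r) x') :=
        expMass_square_mono hc hsub (square_subset_closedHalfPlane hx1)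
    _ ≤ ∑ p ∈ Finset.range n ×ˢ Finset.range n, expMass v (square r (cellCenter n r x' p)) :=
        expMass_square_le_sum hc hr hn0 hx1
    _ ≤ ∑ p ∈ Finset.range n ×ˢ Finset.range n, d * r ^ 2 :=
        Finset.sum_le_sum fun p _ => H _
          (half_le_of_square_subset hr.le (cell_subset_closedHalfPlane hr.le hx1 p))
    _ = d * (n * r) ^ 2 := by simp; ring
    _ ≤ d * (2 * s) ^ 2 := by gcongr
    _ = 4 * d * s ^ 2 := by ring

include h0 in
/-- The Frostman-type bound that makes the logarithmic potential of `e^{-2v}` bounded uniformly in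
the scale: decay of the density along the scales `N ^ j`, `j ≤ k`, with ratio `θ ≥ 1 / 2`, bounds
the mass on squares of side `t` by a constant times `t`. -/
lemma expMass_square_le_linear {N : ℕ} {θ : ℝ} (hN : 2 ≤ N) (hθ : 1 / 2 ≤ θ) {k : ℕ}
    (H : ∀ j ≤ k, ∀ x : Plane, (N : ℝ) ^ j / 2 ≤ x 1 →
      expMass v (square ((N : ℝ) ^ j) x) ≤ θ ^ j * ((N : ℝ) ^ j) ^ 2)
    {t : ℝ} (ht : 0 < t) (htk : t ≤ 4 * (N : ℝ) ^ k) {x : Plane} (hx : t / 2 ≤ x 1) :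
    expMass v (square t x) ≤ 16 * t * (θ ^ k * (N : ℝ) ^ k) := by
  have hN2 : (2 : ℝ) ≤ N := by exact_mod_cast hN
  have hθN : 1 ≤ θ * N := by nlinarith
  have hθ0 : 0 < θ := by linarith
  have hk1 : 1 ≤ θ ^ k * (N : ℝ) ^ k := by
    rw [← mul_pow]; exact one_le_pow₀ hθN
  rcases le_total t 1 with h1 | h1
  · have h2 := expMass_square_le_sq hc h0 ht.le (square_subset_closedHalfPlane hx)
    nlinarith
  · -- the largest scale below `t` among those with `j ≤ k`
    obtain ⟨j, hjk, hjt, hj⟩ : ∃ j ≤ k, (N : ℝ) ^ j ≤ t ∧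
        t * θ ^ j ≤ 4 * (θ ^ k * (N : ℝ) ^ k) := by
      rcases le_total ((N : ℝ) ^ k) t with h | h
      · refine ⟨k, le_rfl, h, ?_⟩
        calc t * θ ^ k ≤ 4 * (N : ℝ) ^ k * θ ^ k := by gcongr
          _ = _ := by ring
      · obtain ⟨j, hj1, hj2⟩ := exists_nat_pow_near h1 (by linarith : (1 : ℝ) < N)
        rcases lt_or_ge j k with hjk | hjk
        · refine ⟨j, hjk.le, hj1, ?_⟩
          have h3 : (θ * N) ^ (j + 1) ≤ (θ * N) ^ k := pow_le_pow_right₀ hθN hjk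
          rw [mul_pow, mul_pow] at h3
          have h5 : θ ^ j ≤ 2 * θ ^ (j + 1) := by
            rw [pow_succ]; nlinarith [pow_pos hθ0 j]
          have h6 : (0 : ℝ) ≤ N ^ (j + 1) * θ ^ (j + 1) := by positivity
          calc t * θ ^ j ≤ (N : ℝ) ^ (j + 1) * (2 * θ ^ (j + 1)) := by gcongr
            _ ≤ 4 * (θ ^ k * (N : ℝ) ^ k) := by linarith
        · have h4 : (N : ℝ) ^ k ≤ N ^ j := pow_le_pow_right₀ (by linarith) hjk
          refine ⟨k, le_rfl, h4.trans hj1, ?_⟩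
          calc t * θ ^ k ≤ (N : ℝ) ^ k * θ ^ k := by gcongr
            _ ≤ 4 * (θ ^ k * (N : ℝ) ^ k) := by linarith
    have h2 := expMass_square_le_four_mul hc (by positivity : 0 < (N : ℝ) ^ j) (by positivity)
      hjt (H j hjk) hx
    calc expMass v (square t x) ≤ 4 * t * (t * θ ^ j) := by linarith
      _ ≤ 4 * t * (4 * (θ ^ k * (N : ℝ) ^ k)) := by gcongr
      _ = _ := by ring

end

/-! ### Weighted means of a solution around a point -/

/-- The mean of `v` around `z` at scale `t` with the kernel `-2 t⁻² χ' (‖y - z‖² / t²)`. The kernel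
is chosen so that its derivative in `t` is `t⁻¹` times the Laplacian of the cutoff of radius `t`. It is
not normalised; its integral does not depend on `t`. -/
noncomputable def cutoffMean (v : Plane → ℝ) (z : Plane) (t : ℝ) : ℝ :=
  ∫ y in openHalfPlane, v y * (-2 * deriv cutoffProfile (‖y - z‖ ^ 2 / t ^ 2) / t ^ 2)

lemma hasDerivAt_cutoff_kernel (r : ℝ) {t : ℝ} (ht : 0 < t) :
    HasDerivAt (fun t : ℝ => -2 * deriv cutoffProfile (r / t ^ 2) / t ^ 2)
      (cutoffLaplacian (r / t ^ 2) / t ^ 3) t := by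
  have ht2 : t ^ 2 ≠ 0 := by positivity
  have h1 : HasDerivAt (fun t : ℝ => r / t ^ 2) _ t :=
    (hasDerivAt_const t r).div (hasDerivAt_pow 2 t) ht2
  have h2 :=
    (contDiff_deriv_cutoffProfile.differentiable (by simp) (r / t ^ 2)).hasDerivAt.comp t h1
  have h3 := (h2.const_mul (-2)).div (hasDerivAt_pow 2 t) ht2
  refine h3.congr_deriv ?_
  unfold cutoffLaplacian
  simp only [Function.comp_apply]
  push_cast
  field_simp
  ring

section
variable {v : Plane → ℝ} (hc : ContinuousOn v closedHalfPlane) {z : Plane}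
include hc

lemma integrableOn_mul_of_eq_zero {w : Plane → ℝ} (hw : Continuous w) {t : ℝ} (hz : t < z 1)
    (h0 : ∀ y, t < ‖y - z‖ → w y = 0) : IntegrableOn (fun y => v y * w y) openHalfPlane := by
  have hb := closedBall_subset_openHalfPlane hz
  have : IntegrableOn (fun y => v y * w y) (Metric.closedBall z t) :=
    ((hc.mono (hb.trans openHalfPlane_subset)).mul hw.continuousOn).integrableOn_compact
      (isCompact_closedBall z t)
  refine this.of_forall_sdiff_eq_zero isOpen_openHalfPlane.measurableSet fun y hy => ?_
  rw [h0 y, mul_zero]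
  simpa [dist_eq_norm] using hy.2

omit hc in
lemma continuous_comp_radial {g : ℝ → ℝ} (hg : Continuous g) (z : Plane) (t : ℝ) :
    Continuous (fun y : Plane => g (‖y - z‖ ^ 2 / t ^ 2)) := by
  fun_prop

lemma integrableOn_mul_radial {g : ℝ → ℝ} (hg : Continuous g) (hg0 : ∀ s, 1 ≤ s → g s = 0)
    {t : ℝ} (ht : 0 < t) (hz : t < z 1) :
    IntegrableOn (fun y => v y * g (‖y - z‖ ^ 2 / t ^ 2)) openHalfPlane :=
  integrableOn_mul_of_eq_zero hc (continuous_comp_radial hg z t) hz fun _ hy =>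
    hg0 _ (one_le_sq_div_of_le_norm_sub ht hy.le)

lemma integrableOn_cutoffMean {t : ℝ} (ht : 0 < t) (hz : t < z 1) :
    IntegrableOn (fun y => v y * (-2 * deriv cutoffProfile (‖y - z‖ ^ 2 / t ^ 2) / t ^ 2))
      openHalfPlane :=
  integrableOn_mul_radial hc (g := fun s => -2 * deriv cutoffProfile s / t ^ 2)
    ((continuous_const.mul contDiff_deriv_cutoffProfile.continuous).div_const _)
    (fun s hs => by simp [deriv_cutoffProfile_eq_zero hs]) ht hz

lemma hasDerivAt_cutoffMean {t : ℝ} (ht : 0 < t) (hz : t < z 1) :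
    HasDerivAt (cutoffMean v z)
      (∫ y in openHalfPlane, v y * (cutoffLaplacian (‖y - z‖ ^ 2 / t ^ 2) / t ^ 3)) t := by
  set T := (t + z 1) / 2 with hT
  have hTz : T < z 1 := by linarith
  have hb := closedBall_subset_openHalfPlane hTz
  obtain ⟨M, hM⟩ := (isCompact_closedBall z T).exists_bound_of_continuousOn
    (hc.mono (hb.trans openHalfPlane_subset))
  obtain ⟨D, hD0, hD⟩ := exists_bound_of_vanishing continuous_cutoffLaplacian
    fun _ => cutoffLaplacian_eq_zero
  have hmeas : AEStronglyMeasurable v (volume.restrict openHalfPlane) :=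
    (hc.mono openHalfPlane_subset).aestronglyMeasurable isOpen_openHalfPlane.measurableSet
  refine (hasDerivAt_integral_of_dominated_loc_of_deriv_le (s := Ioo (t / 2) T)
    (μ := volume.restrict openHalfPlane)
    (F := fun t y => v y * (-2 * deriv cutoffProfile (‖y - z‖ ^ 2 / t ^ 2) / t ^ 2))
    (bound := (Metric.closedBall z T).indicator fun _ => M * (D / (t / 2) ^ 3))
    (F' := fun t y => v y * (cutoffLaplacian (‖y - z‖ ^ 2 / t ^ 2) / t ^ 3))
    (Ioo_mem_nhds (by linarith) (by linarith)) ?_ (integrableOn_cutoffMean hc ht hz) ?_ ?_ ?_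
    ?_).2
  · refine Filter.Eventually.of_forall fun τ => hmeas.mul ?_
    exact (((continuous_const.mul (continuous_comp_radial contDiff_deriv_cutoffProfile.continuous
      z τ)).div_const _)).aestronglyMeasurable
  · exact hmeas.mul ((continuous_comp_radial continuous_cutoffLaplacian
      z t).div_const _).aestronglyMeasurable
  · refine Filter.Eventually.of_forall fun y τ hτ => ?_
    have hτ0 : 0 < τ := by linarith [hτ.1]
    by_cases hy : y ∈ Metric.closedBall z T
    · rw [indicator_of_mem hy, norm_mul, norm_div, Real.norm_eq_abs (cutoffLaplacian _),
        Real.norm_of_nonneg (by positivity : 0 ≤ τ ^ 3)]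
      have := hτ.1.le
      have hM0 : 0 ≤ M := (norm_nonneg _).trans (hM y hy)
      gcongr
      · exact hM y hy
      · exact hD _ (by positivity)
    · rw [indicator_of_notMem hy, cutoffLaplacian_eq_zero, zero_div, mul_zero, norm_zero]
      refine one_le_sq_div_of_le_norm_sub hτ0 ?_
      rw [Metric.mem_closedBall, dist_eq_norm, not_le] at hy
      exact (hτ.2.trans hy).le
  · refine ((integrable_indicator_iff Metric.isClosed_closedBall.measurableSet).2 ?_).integrableOn
    exact integrableOn_const (isCompact_closedBall z T).measure_lt_top.ne
  · refine Filter.Eventually.of_forall fun y τ hτ => ?_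
    exact (hasDerivAt_cutoff_kernel _ (by linarith [hτ.1])).const_mul _

omit hc in
lemma mem_square_of_norm_sub_le {y : Plane} {t : ℝ} (h : ‖y - z‖ ≤ t) :
    y ∈ square (2 * t) z := by
  intro i
  have h1 : |(y - z) i| ≤ ‖y - z‖ := by simpa using PiLp.norm_apply_le (y - z) i
  rw [PiLp.sub_apply] at h1
  linarith

omit hc in
lemma norm_sub_sq_le_of_mem_square {y : Plane} {R : ℝ} (h : y ∈ square R z) :
    ‖y - z‖ ^ 2 ≤ R ^ 2 / 2 := by
  rw [EuclideanSpace.real_norm_sq_eq, Fin.sum_univ_two]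
  have h0 := sq_le_sq' (abs_le.1 (h 0)).1 (abs_le.1 (h 0)).2
  have h1 := sq_le_sq' (abs_le.1 (h 1)).1 (abs_le.1 (h 1)).2
  simp only [PiLp.sub_apply]
  linarith

/-- Testing the equation against a cutoff at scale `t`: the right-hand side is at most `Lam` times
the mass of `e^{-2v}` in the circumscribed square. -/
lemma integral_cutoff_le {K : Plane → ℝ} {Lam t : ℝ} (hL : 0 ≤ Lam)
    (hK : ∀ x ∈ openHalfPlane, 0 ≤ K x ∧ K x ≤ Lam) (ht : 0 < t) (hz : t < z 1) :
    ∫ y in openHalfPlane, K y * Real.exp (-2 * v y) * cutoffProfile (‖y - z‖ ^ 2 / t ^ 2)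
      ≤ Lam * expMass v (square (2 * t) z) := by
  have hs : square (2 * t) z ⊆ closedHalfPlane := square_subset_closedHalfPlane (by linarith)
  have hm : MeasurableSet (square (2 * t) z) := (isCompact_square _ _).measurableSet
  have hi := integrableOn_exp_square hc hs
  rw [expMass, ← integral_const_mul]
  calc _ ≤ ∫ y in openHalfPlane,
        (square (2 * t) z).indicator (fun y => Lam * Real.exp (-2 * v y)) y := by
        refine integral_mono_of_nonneg ?_
          ((integrable_indicator_iff hm).2 (hi.const_mul Lam)).integrableOn ?_
        · filter_upwards [ae_restrict_mem isOpen_openHalfPlane.measurableSet] with y hy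
          exact mul_nonneg (mul_nonneg (hK y hy).1 (Real.exp_pos _).le) (cutoffProfile_nonneg _)
        · filter_upwards [ae_restrict_mem isOpen_openHalfPlane.measurableSet] with y hy
          by_cases hyt : ‖y - z‖ ≤ t
          · rw [indicator_of_mem (mem_square_of_norm_sub_le hyt)]
            have h1 := mul_le_mul_of_nonneg_right (hK y hy).2 (Real.exp_pos (-2 * v y)).le
            have h2 := cutoffProfile_le_one (‖y - z‖ ^ 2 / t ^ 2)
            have h3 := mul_nonneg (hK y hy).1 (Real.exp_pos (-2 * v y)).le
            exact (mul_le_of_le_one_right h3 h2).trans h1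
          · rw [cutoffProfile_eq_zero (one_le_sq_div_of_le_norm_sub ht (not_le.1 hyt).le),
              mul_zero]
            exact indicator_nonneg (fun y _ => mul_nonneg hL (Real.exp_pos _).le) y
    _ ≤ ∫ y, (square (2 * t) z).indicator (fun y => Lam * Real.exp (-2 * v y)) y := by
        refine setIntegral_le_integral ((integrable_indicator_iff hm).2 (hi.const_mul Lam))
          (Filter.Eventually.of_forall fun y => ?_)
        exact indicator_nonneg (fun y _ => mul_nonneg hL (Real.exp_pos _).le) y
    _ = ∫ y in square (2 * t) z, Lam * Real.exp (-2 * v y) := integral_indicator hm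

/-- Means at small scales are controlled by the value at the centre. -/
lemma exists_cutoffMean_le (hz : 0 < z 1) {B : ℝ} (hv0 : ∀ x ∈ closedHalfPlane, 0 ≤ v x)
    (hB : ∀ s, 0 ≤ s → |deriv cutoffProfile s| ≤ B) {T : ℝ} (hT : 0 < T) :
    ∃ t, 0 < t ∧ t < T ∧ cutoffMean v z t ≤ 8 * B * (v z + 1) := by
  have hzH : z ∈ openHalfPlane := hz
  have hcz : ContinuousAt v z :=
    (hc.mono openHalfPlane_subset).continuousAt (isOpen_openHalfPlane.mem_nhds hzH)
  obtain ⟨ε, hε, hε'⟩ := Metric.eventually_nhds_iff.1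
    (hcz.eventually (gt_mem_nhds (lt_add_one (v z))))
  set t := min (min (ε / 2) (T / 2)) (z 1 / 2) with ht
  have ht0 : 0 < t := by positivity
  have htz : t < z 1 := (min_le_right _ _).trans_lt (by linarith)
  have htT : t < T := ((min_le_left _ _).trans (min_le_right _ _)).trans_lt (by linarith)
  have htε : t < ε := ((min_le_left _ _).trans (min_le_left _ _)).trans_lt (by linarith)
  have hB0 : 0 ≤ B := (abs_nonneg _).trans (hB 0 le_rfl)
  have hvz : 0 ≤ v z := hv0 z (openHalfPlane_subset hzH)
  have hm : MeasurableSet (square (2 * t) z) := (isCompact_square _ _).measurableSet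
  refine ⟨t, ht0, htT, ?_⟩
  have hi : Integrable ((square (2 * t) z).indicator fun _ => (v z + 1) * (2 * B / t ^ 2)) :=
    (integrable_indicator_iff hm).2
      (integrableOn_const (isCompact_square _ _).measure_lt_top.ne)
  have hnn : ∀ y, 0 ≤ (square (2 * t) z).indicator (fun _ => (v z + 1) * (2 * B / t ^ 2)) y :=
    indicator_nonneg fun _ _ => by positivity
  calc cutoffMean v z t ≤ ∫ y in openHalfPlane,
        (square (2 * t) z).indicator (fun _ => (v z + 1) * (2 * B / t ^ 2)) y := by
        refine setIntegral_mono_on (integrableOn_cutoffMean hc ht0 htz) hi.integrableOn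
          isOpen_openHalfPlane.measurableSet fun y hy => ?_
        by_cases hyt : ‖y - z‖ ≤ t
        · rw [indicator_of_mem (mem_square_of_norm_sub_le hyt)]
          have h1 : v y ≤ v z + 1 := (hε' (by rw [dist_eq_norm]; linarith)).le
          have h2 := (abs_le.1 (hB (‖y - z‖ ^ 2 / t ^ 2) (by positivity))).1
          have h3 := deriv_cutoffProfile_nonpos (‖y - z‖ ^ 2 / t ^ 2)
          refine mul_le_mul h1 ?_ (div_nonneg (by linarith) (by positivity)) (by linarith)
          gcongr ?_ / _
          linarith
        · rw [deriv_cutoffProfile_eq_zero (one_le_sq_div_of_le_norm_sub ht0 (not_le.1 hyt).le)]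
          simpa using hnn y
    _ ≤ ∫ y, (square (2 * t) z).indicator (fun _ => (v z + 1) * (2 * B / t ^ 2)) y :=
        setIntegral_le_integral hi (Filter.Eventually.of_forall hnn)
    _ = 8 * B * (v z + 1) := by
        rw [integral_indicator hm, setIntegral_const, volume_real_square (by positivity),
          smul_eq_mul]
        field_simp
        ring

/-- Growth of the means of a solution, when the mass of `e^{-2v}` grows at most linearly in the
scale. -/
lemma cutoffMean_le {K : Plane → ℝ} {Lam G T : ℝ} (hL : 0 ≤ Lam)
    (hK : ∀ x ∈ openHalfPlane, 0 ≤ K x ∧ K x ≤ Lam) (hv0 : ∀ x ∈ closedHalfPlane, 0 ≤ v x)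
    (heq : HasDistribLaplacian v fun x => K x * Real.exp (-2 * v x)) (hT : 0 < T) (hz : T < z 1)
    (hG : ∀ t, 0 < t → t ≤ T → expMass v (square (2 * t) z) ≤ G * t) {B : ℝ}
    (hB : ∀ s, 0 ≤ s → |deriv cutoffProfile s| ≤ B) :
    cutoffMean v z T ≤ 8 * B * (v z + 1) + Lam * G * T := by
  obtain ⟨t, ht0, htT, ht⟩ := exists_cutoffMean_le hc (hT.trans hz) hv0 hB hT
  have hd : ∀ τ ∈ Icc t T, HasDerivAt (cutoffMean v z)
      (∫ y in openHalfPlane, v y * (cutoffLaplacian (‖y - z‖ ^ 2 / τ ^ 2) / τ ^ 3)) τ :=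
    fun τ hτ => hasDerivAt_cutoffMean hc (ht0.trans_le hτ.1) (hτ.2.trans_lt hz)
  have hd' : ∀ τ ∈ Icc t T, deriv (cutoffMean v z) τ ≤ Lam * G := by
    intro τ hτ
    have hτ0 : 0 < τ := ht0.trans_le hτ.1
    have hτz : τ < z 1 := hτ.2.trans_lt hz
    rw [(hd τ hτ).deriv]
    have h1 : ∀ y : Plane, v y * (cutoffLaplacian (‖y - z‖ ^ 2 / τ ^ 2) / τ ^ 3) =
        v y * (cutoffLaplacian (‖y - z‖ ^ 2 / τ ^ 2) / τ ^ 2) * τ⁻¹ := by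
      intro y
      field_simp
    simp only [h1]
    rw [integral_mul_const, heq.integral_cutoff hτ0 hτz, ← div_eq_mul_inv, div_le_iff₀ hτ0]
    refine (integral_cutoff_le hc hL hK hτ0 hτz).trans ?_
    rw [mul_assoc]
    exact mul_le_mul_of_nonneg_left (hG τ hτ0 hτ.2) hL
  have hmono := (convex_Icc t T).image_sub_le_mul_sub_of_deriv_le
    (f := cutoffMean v z) (C := Lam * G)
    (fun τ hτ => (hd τ hτ).continuousAt.continuousWithinAt)
    (fun τ hτ => (hd τ (interior_subset hτ)).differentiableAt.differentiableWithinAt)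
    (fun τ hτ => hd' τ (interior_subset hτ)) t (left_mem_Icc.2 htT.le) T
    (right_mem_Icc.2 htT.le) htT.le
  have hG0 : 0 ≤ G := by
    have h1 : 0 ≤ expMass v (square (2 * T) z) :=
      integral_nonneg fun y => (Real.exp_pos _).le
    exact nonneg_of_mul_nonneg_left (h1.trans (hG T hT le_rfl)) hT
  have : Lam * G * (T - t) ≤ Lam * G * T := by
    have := mul_nonneg hL hG0
    gcongr
    linarith
  linarith

/-- The mean at scale `2 R` around a point of a square of side `R` controls the integral over that
square. -/
lemma integral_square_le_cutoffMean {c R : ℝ} (hc0 : 0 < c) (hv0 : ∀ x ∈ closedHalfPlane, 0 ≤ v x)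
    (hcut : ∀ s, 0 ≤ s → s ≤ 1 / 2 → c ≤ -deriv cutoffProfile s) (hR : 0 < R) (hz : 2 * R < z 1)
    {x : Plane} (hzx : z ∈ square R x) :
    ∫ y in square R x, v y ≤ 2 * R ^ 2 / c * cutoffMean v z (2 * R) := by
  have hsub : square R x ⊆ openHalfPlane := by
    intro y hy
    have h1 := (abs_le.1 (hy 1)).1
    have h2 := (abs_le.1 (hzx 1)).2
    change 0 < y 1
    linarith
  have hm : MeasurableSet (square R x) := (isCompact_square _ _).measurableSet
  have hi := integrableOn_cutoffMean hc (by positivity : 0 < 2 * R) hz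
  rw [cutoffMean, ← integral_const_mul]
  calc ∫ y in square R x, v y ≤ ∫ y in square R x, 2 * R ^ 2 / c *
        (v y * (-2 * deriv cutoffProfile (‖y - z‖ ^ 2 / (2 * R) ^ 2) / (2 * R) ^ 2)) := by
        refine setIntegral_mono_on ((hc.mono (hsub.trans openHalfPlane_subset)).integrableOn_compact
          (isCompact_square _ _)) ((hi.mono_set hsub).const_mul _) hm fun y hy => ?_
        have hyz : ‖y - z‖ ^ 2 ≤ (2 * R) ^ 2 / 2 := by
          refine norm_sub_sq_le_of_mem_square (fun i => ?_)
          have h1 := abs_le.1 (hy i)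
          have h2 := abs_le.1 (hzx i)
          rw [abs_le]
          constructor <;> linarith
        have h1 := hcut (‖y - z‖ ^ 2 / (2 * R) ^ 2) (by positivity) (by
          rw [div_le_iff₀ (by positivity)]
          linarith)
        have h2 : v y * 1 ≤ v y * (-deriv cutoffProfile (‖y - z‖ ^ 2 / (2 * R) ^ 2) / c) :=
          mul_le_mul_of_nonneg_left ((one_le_div hc0).2 h1)
            (hv0 y (openHalfPlane_subset (hsub hy)))
        calc v y ≤ v y * (-deriv cutoffProfile (‖y - z‖ ^ 2 / (2 * R) ^ 2) / c) := by linarith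
          _ = _ := by
            field_simp
    _ ≤ _ := by
        refine setIntegral_mono_set (hi.const_mul _) ?_ hsub.eventuallyLE
        filter_upwards [ae_restrict_mem isOpen_openHalfPlane.measurableSet] with y hy
        have h3 := deriv_cutoffProfile_nonpos (‖y - z‖ ^ 2 / (2 * R) ^ 2)
        have h4 := hv0 y (openHalfPlane_subset hy)
        exact mul_nonneg (by positivity) (mul_nonneg h4 (div_nonneg (by linarith) (by positivity)))

end

/-! ### Decay of the density from one scale to the next -/

section
variable {v : Plane → ℝ} (hc : ContinuousOn v closedHalfPlane)
include hc

/-- A lower bound for the mass of every cell: the others have at most the maximal mass `a`. -/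
lemma half_lt_expMass_cell {n : ℕ} {r a : ℝ} (hr : 0 < r) (hn : 0 < n) {x : Plane}
    (hx : n * r / 2 ≤ x 1) (hcell : ∀ p, expMass v (square r (cellCenter n r x p)) ≤ a)
    (htot : a * (n ^ 2 - 1 / 2) < expMass v (square (n * r) x)) {p : ℕ × ℕ}
    (hp : p ∈ Finset.range n ×ˢ Finset.range n) :
    a / 2 < expMass v (square r (cellCenter n r x p)) := by
  have h1 := expMass_square_le_sum hc hr hn hx
  rw [← Finset.add_sum_erase _ _ hp] at h1
  have h2 := Finset.sum_le_card_nsmul ((Finset.range n ×ˢ Finset.range n).erase p)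
    (fun p => expMass v (square r (cellCenter n r x p))) a fun q _ => hcell q
  rw [Finset.card_erase_of_mem hp, Finset.card_product, Finset.card_range, nsmul_eq_mul,
    Nat.cast_sub (Nat.succ_le_of_lt (Nat.mul_pos hn hn))] at h2
  push_cast at h2
  nlinarith

/-- A lower bound for the mass of the concentric square made of `(2 * m + 1) ^ 2` cells. -/
lemma expMass_inner_ge {m : ℕ} {r a : ℝ} (hr : 0 < r) {x : Plane}
    (hx : (4 * m + 9 : ℕ) * r / 2 ≤ x 1)
    (hcell : ∀ p, expMass v (square r (cellCenter (4 * m + 9) r x p)) ≤ a) (ha : 0 ≤ a)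
    (htot : a * ((4 * m + 9 : ℕ) ^ 2 - 1 / 2) < expMass v (square ((4 * m + 9 : ℕ) * r) x)) :
    a * (2 * m + 1) ^ 2 / 2 ≤ expMass v (square ((2 * m + 1) * r) x) := by
  set n := 4 * m + 9 with hn
  have hnm : (n : ℝ) = 4 * m + 9 := by rw [hn]; push_cast; ring
  set I := Finset.Icc (m + 4) (3 * m + 4) ×ˢ Finset.Icc (m + 4) (3 * m + 4) with hI
  have hIsub : I ⊆ Finset.range n ×ˢ Finset.range n := by
    refine Finset.product_subset_product ?_ ?_ <;>
    · intro i hi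
      rw [Finset.mem_Icc] at hi
      rw [Finset.mem_range]
      omega
  have hcard : I.card = (2 * m + 1) * (2 * m + 1) := by
    rw [hI, Finset.card_product, Nat.card_Icc]
    congr 1 <;> omega
  have hcomp : ∀ {i : ℕ} {u : ℝ}, m + 4 ≤ i → i ≤ 3 * m + 4 →
      |u - (i - ((n : ℝ) - 1) / 2) * r| ≤ r / 2 → |u| ≤ (2 * m + 1) * r / 2 := by
    intro i u h1 h2 h3
    have h1' : (m : ℝ) + 4 ≤ i := by exact_mod_cast h1
    have h2' : (i : ℝ) ≤ 3 * m + 4 := by exact_mod_cast h2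
    rw [hnm, abs_le] at h3
    rw [abs_le]
    constructor <;> nlinarith
  have hUQ : square ((2 * m + 1) * r) x ⊆ square (n * r) x := by
    intro y hy i
    refine (hy i).trans ?_
    rw [hnm]
    have : (0 : ℝ) ≤ m * r := by positivity
    linarith
  have hQ := integrableOn_exp_square hc (square_subset_closedHalfPlane hx)
  have hmU : MeasurableSet (square ((2 * m + 1) * r) x) := (isCompact_square _ _).measurableSet
  have hmQ : MeasurableSet (square (n * r) x) := (isCompact_square _ _).measurableSet
  have hout : ∫ y in square (n * r) x \ square ((2 * m + 1) * r) x, Real.exp (-2 * v y) ≤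
      ∑ p ∈ (Finset.range n ×ˢ Finset.range n) \ I,
        expMass v (square r (cellCenter n r x p)) := by
    refine setIntegral_le_sum_of_subset_biUnion (hmQ.diff hmU)
      (fun _ _ => (isCompact_square _ _).measurableSet)
      (fun p _ => integrableOn_exp_square hc (cell_subset_closedHalfPlane hr.le hx p))
      (fun _ _ _ _ => (Real.exp_pos _).le) (fun y hy => ?_)
    obtain ⟨p, hp, hyp⟩ := exists_cell hr (by omega) hy.1
    refine ⟨p, Finset.mem_sdiff.2 ⟨hp, fun hpI => hy.2 ?_⟩, hyp⟩
    obtain ⟨h1, h2⟩ := Finset.mem_product.1 hpI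
    rw [Finset.mem_Icc] at h1 h2
    have h3 := hyp 0
    have h4 := hyp 1
    rw [cellCenter_zero, ← sub_sub] at h3
    rw [cellCenter_one, ← sub_sub] at h4
    intro i
    fin_cases i
    · exact hcomp h1.1 h1.2 h3
    · exact hcomp h2.1 h2.2 h4
  have hsum := Finset.sum_le_card_nsmul ((Finset.range n ×ˢ Finset.range n) \ I)
    (fun p => expMass v (square r (cellCenter n r x p))) a fun q _ => hcell q
  rw [Finset.card_sdiff_of_subset hIsub, Finset.card_product, Finset.card_range, hcard,
    nsmul_eq_mul, Nat.cast_sub (Nat.mul_le_mul (by omega) (by omega))] at hsum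
  have hsplit := setIntegral_sdiff hmU hQ hUQ
  rw [hsplit] at hout
  have hdef : expMass v (square (n * r) x) = ∫ y in square (n * r) x, Real.exp (-2 * v y) := rfl
  have hdef' : expMass v (square ((2 * m + 1) * r) x) =
    ∫ y in square ((2 * m + 1) * r) x, Real.exp (-2 * v y) := rfl
  push_cast at hsum
  have : 0 ≤ a * (2 * m + 1) ^ 2 - a := by
    have : (0 : ℝ) ≤ m := by positivity
    nlinarith [mul_nonneg ha this, mul_nonneg (mul_nonneg ha this) this]
  linarith

/-- A square of density more than `d / 2` contains a point at which `v` is small. -/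
lemma exists_le_inv_of_expMass {R d : ℝ} (hR : 0 ≤ R) (hd : 0 < d) {x : Plane}
    (h : square R x ⊆ closedHalfPlane) (hm : d * R ^ 2 / 2 < expMass v (square R x)) :
    ∃ z ∈ square R x, v z ≤ 1 / d := by
  by_contra! hcon
  have := expMass_square_le_of_le hc hR h (d := d / 2) fun y hy => by
    have h1 := (hcon y hy).le
    -- `e^{2v} ≥ 2v ≥ 2 / d`
    have h2 := Real.add_one_le_exp (2 * v y)
    have h3 : 2 / d ≤ Real.exp (2 * v y) := by
      have : 2 / d = 2 * (1 / d) := by ring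
      linarith
    rw [neg_mul, Real.exp_neg]
    calc (Real.exp (2 * v y))⁻¹ ≤ (2 / d)⁻¹ := by gcongr
      _ = d / 2 := by simp
  linarith

/-- Testing the equation against a cutoff at scale `t`: the left-hand side is at most `D t⁻²` times
the integral of `v` over the disc. -/
lemma integral_cutoffLaplacian_le (hv0 : ∀ x ∈ closedHalfPlane, 0 ≤ v x) {D : ℝ}
    (hD : ∀ s, 0 ≤ s → |cutoffLaplacian s| ≤ D) {x : Plane} {t : ℝ} (ht : 0 < t) (hx : t < x 1) :
    ∫ y in openHalfPlane, v y * (cutoffLaplacian (‖y - x‖ ^ 2 / t ^ 2) / t ^ 2)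
      ≤ D / t ^ 2 * ∫ y in Metric.ball x t, v y := by
  have hb := closedBall_subset_openHalfPlane hx
  have hb' : Metric.ball x t ⊆ openHalfPlane := Metric.ball_subset_closedBall.trans hb
  have hi : IntegrableOn v (Metric.ball x t) :=
    ((hc.mono (hb.trans openHalfPlane_subset)).integrableOn_compact
      (isCompact_closedBall x t)).mono_set Metric.ball_subset_closedBall
  have hw : IntegrableOn (fun y => v y * (cutoffLaplacian (‖y - x‖ ^ 2 / t ^ 2) / t ^ 2))
      openHalfPlane :=
    integrableOn_mul_radial hc (g := fun s => cutoffLaplacian s / t ^ 2)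
      (continuous_cutoffLaplacian.div_const _)
      (fun s hs => by simp [cutoffLaplacian_eq_zero hs]) ht hx
  have hzero : ∀ y ∈ openHalfPlane \ Metric.ball x t,
      v y * (cutoffLaplacian (‖y - x‖ ^ 2 / t ^ 2) / t ^ 2) = 0 := by
    intro y hy
    have : t ≤ ‖y - x‖ := by simpa [dist_eq_norm] using hy.2
    rw [cutoffLaplacian_eq_zero (one_le_sq_div_of_le_norm_sub ht this), zero_div, mul_zero]
  rw [setIntegral_eq_of_subset_of_forall_sdiff_eq_zero isOpen_openHalfPlane.measurableSet hb'
    hzero, ← integral_const_mul]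
  refine setIntegral_mono_on (hw.mono_set hb') (hi.const_mul _) Metric.isOpen_ball.measurableSet
    fun y hy => ?_
  rw [mul_comm]
  refine mul_le_mul_of_nonneg_right ?_ (hv0 y (openHalfPlane_subset (hb' hy)))
  gcongr
  exact (abs_le.1 (hD _ (by positivity))).2

/-- Testing the equation against a cutoff at scale `t`: the right-hand side is at least `lam * c`
times the mass of `e^{-2v}` in the inscribed square of side `t`. -/
lemma le_integral_cutoff {K : Plane → ℝ} {lam Lam c t : ℝ} (hlam : 0 < lam) (hc0 : 0 < c)
    (hKm : Measurable K) (hK : ∀ x ∈ openHalfPlane, lam ≤ K x ∧ K x ≤ Lam)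
    (hcut : ∀ s, 0 ≤ s → s ≤ 1 / 2 → c ≤ cutoffProfile s) (ht : 0 < t) {x : Plane}
    (hx : t < x 1) :
    lam * c * expMass v (square t x) ≤
      ∫ y in openHalfPlane, K y * Real.exp (-2 * v y) * cutoffProfile (‖y - x‖ ^ 2 / t ^ 2) := by
  have hcexp : ContinuousOn (fun y => Real.exp (-2 * v y)) closedHalfPlane := by fun_prop
  have hi := integrableOn_mul_radial hcexp contDiff_cutoffProfile.continuous
    (fun _ => cutoffProfile_eq_zero) ht hx
  have hi' : IntegrableOn (fun y => K y * Real.exp (-2 * v y) *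
      cutoffProfile (‖y - x‖ ^ 2 / t ^ 2)) openHalfPlane := by
    refine (hi.const_mul Lam).mono' ?_ ?_
    · simp only [mul_assoc]
      exact hKm.aestronglyMeasurable.mul hi.aestronglyMeasurable
    · filter_upwards [ae_restrict_mem isOpen_openHalfPlane.measurableSet] with y hy
      have h1 := hK y hy
      have h2 := cutoffProfile_nonneg (‖y - x‖ ^ 2 / t ^ 2)
      have h3 := (Real.exp_pos (-2 * v y)).le
      have h4 : 0 ≤ K y := hlam.le.trans h1.1
      rw [Real.norm_of_nonneg (by positivity), mul_assoc]
      exact mul_le_mul_of_nonneg_right h1.2 (by positivity)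
  have hsub : square t x ⊆ openHalfPlane := by
    intro y hy
    have := (abs_le.1 (hy 1)).1
    change 0 < y 1
    linarith
  rw [expMass, ← integral_const_mul]
  calc ∫ y in square t x, lam * c * Real.exp (-2 * v y)
      ≤ ∫ y in square t x, K y * Real.exp (-2 * v y) * cutoffProfile (‖y - x‖ ^ 2 / t ^ 2) := by
        refine setIntegral_mono_on ((integrableOn_exp_square hc
          (hsub.trans openHalfPlane_subset)).const_mul _) (hi'.mono_set hsub)
          (isCompact_square _ _).measurableSet fun y hy => ?_
        have h1 := hcut (‖y - x‖ ^ 2 / t ^ 2) (by positivity) (by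
          rw [div_le_iff₀ (by positivity)]
          linarith [norm_sub_sq_le_of_mem_square hy])
        have h2 := (hK y (hsub hy)).1
        have h3 := (Real.exp_pos (-2 * v y)).le
        calc lam * c * Real.exp (-2 * v y) = lam * Real.exp (-2 * v y) * c := by ring
          _ ≤ _ := by
            have : 0 ≤ K y := hlam.le.trans h2
            gcongr
    _ ≤ _ := by
        refine setIntegral_mono_set hi' ?_ hsub.eventuallyLE
        filter_upwards [ae_restrict_mem isOpen_openHalfPlane.measurableSet] with y hy
        exact mul_nonneg (mul_nonneg (hlam.le.trans (hK y hy).1) (Real.exp_pos _).le)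
          (cutoffProfile_nonneg _)

/-- If `v` is small somewhere in a square of side `R` and the mass of `e^{-2v}` grows at most
linearly up to scale `4 * R`, then `v` is small on average over the square. -/
lemma integral_square_le {K : Plane → ℝ} {Lam c B d R : ℝ} (hL : 0 ≤ Lam)
    (hK : ∀ x ∈ openHalfPlane, 0 ≤ K x ∧ K x ≤ Lam) (hv0 : ∀ x ∈ closedHalfPlane, 0 ≤ v x)
    (heq : HasDistribLaplacian v fun x => K x * Real.exp (-2 * v x)) (hc0 : 0 < c)
    (hcut : ∀ s, 0 ≤ s → s ≤ 1 / 2 → c ≤ -deriv cutoffProfile s)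
    (hB : ∀ s, 0 ≤ s → |deriv cutoffProfile s| ≤ B) (hR : 1 ≤ R) (hdR : 1 ≤ d * R)
    (hd : 0 < d)
    (hlin : ∀ t, 0 < t → t ≤ 4 * R → ∀ x : Plane, t / 2 ≤ x 1 →
      expMass v (square t x) ≤ 16 * t * (d * R))
    {x z : Plane} (hzx : z ∈ square R x) (hz : 2 * R < z 1) (hvz : v z ≤ 1 / d) :
    ∫ y in square R x, v y ≤ 2 / c * (16 * B + 64 * Lam) * (d * R ^ 4) := by
  have hR0 : 0 < R := by linarith
  have h1 := integral_square_le_cutoffMean hc hc0 hv0 hcut hR0 hz hzx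
  have h2 := cutoffMean_le hc hL hK hv0 heq (by linarith : 0 < 2 * R) hz (G := 32 * (d * R))
    (fun t ht htT => (hlin (2 * t) (by linarith) (by linarith) z (by linarith)).trans_eq (by ring))
    hB
  have hB0 : 0 ≤ B := (abs_nonneg _).trans (hB 0 le_rfl)
  have h3 : v z ≤ d * R ^ 2 := by
    refine hvz.trans ?_
    rw [div_le_iff₀ hd]
    nlinarith
  have h4 : 1 ≤ d * R ^ 2 := by nlinarith
  calc ∫ y in square R x, v y ≤ 2 * R ^ 2 / c * cutoffMean v z (2 * R) := h1
    _ ≤ 2 * R ^ 2 / c * (8 * B * (d * R ^ 2 + d * R ^ 2) + Lam * (32 * (d * R)) * (2 * R)) := by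
        refine mul_le_mul_of_nonneg_left (h2.trans ?_) (by positivity)
        gcongr
    _ = _ := by ring

/-- One step of the induction: if the density at the scales `N ^ j`, `j ≤ k`, is at most `θ ^ j`,
then at scale `N ^ (k + 1)` it is at most `θ ^ (k + 1)`, where `θ = 1 - 1 / (2 * N ^ 2)` and
`N = 4 * m + 9` with `m` large. -/
lemma expMass_square_pow_succ_le {K : Plane → ℝ} {lam Lam c B D : ℝ} (hlam : 0 < lam)
    (hKm : Measurable K) (hK : ∀ x ∈ openHalfPlane, lam ≤ K x ∧ K x ≤ Lam)
    (hv0 : ∀ x ∈ closedHalfPlane, 0 ≤ v x)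
    (heq : HasDistribLaplacian v fun x => K x * Real.exp (-2 * v x)) (hc0 : 0 < c)
    (hcut : ∀ s, 0 ≤ s → s ≤ 1 / 2 → c ≤ cutoffProfile s ∧ c ≤ -deriv cutoffProfile s)
    (hB : ∀ s, 0 ≤ s → |deriv cutoffProfile s| ≤ B)
    (hD : ∀ s, 0 ≤ s → |cutoffLaplacian s| ≤ D) {m : ℕ}
    (hbig : D * 81 * (2 / c * (16 * B + 64 * Lam)) < lam * c / 2 * (2 * m + 1) ^ 2) {θ : ℝ}
    (hθ : θ = 1 - 1 / (2 * ((4 * m + 9 : ℕ) : ℝ) ^ 2)) {k : ℕ}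
    (H : ∀ j ≤ k, ∀ x : Plane, ((4 * m + 9 : ℕ) : ℝ) ^ j / 2 ≤ x 1 →
      expMass v (square (((4 * m + 9 : ℕ) : ℝ) ^ j) x) ≤
        θ ^ j * (((4 * m + 9 : ℕ) : ℝ) ^ j) ^ 2)
    {x : Plane} (hx : ((4 * m + 9 : ℕ) : ℝ) ^ (k + 1) / 2 ≤ x 1) :
    expMass v (square (((4 * m + 9 : ℕ) : ℝ) ^ (k + 1)) x) ≤
      θ ^ (k + 1) * (((4 * m + 9 : ℕ) : ℝ) ^ (k + 1)) ^ 2 := by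
  by_contra! hcon
  set n := 4 * m + 9 with hn
  have hnm : (n : ℝ) = 4 * m + 9 := by rw [hn]; push_cast; ring
  have hm0 : (0 : ℝ) ≤ m := by positivity
  have hn9 : (9 : ℝ) ≤ n := by linarith
  have hθ2 : θ * n ^ 2 = n ^ 2 - 1 / 2 := by
    rw [hθ]
    field_simp
  have hθh : 1 / 2 ≤ θ := by
    by_contra! hlt
    nlinarith
  set R : ℝ := (n : ℝ) ^ k with hRdef
  set d : ℝ := θ ^ k with hddef
  have hR1 : 1 ≤ R := one_le_pow₀ (by linarith)
  have hR0 : 0 < R := by linarith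
  have hd0 : 0 < d := pow_pos (by linarith) k
  have hdR : 1 ≤ d * R := by
    rw [hddef, hRdef, ← mul_pow]
    exact one_le_pow₀ (by nlinarith)
  have hnR : (n : ℝ) ^ (k + 1) = n * R := by rw [pow_succ, mul_comm]
  have hL : 0 < Lam := by
    have hmem : (!₂[0, 1] : Plane) ∈ openHalfPlane := by
      change (0 : ℝ) < 1
      norm_num
    exact hlam.trans_le ((hK _ hmem).1.trans (hK _ hmem).2)
  have hK' : ∀ x ∈ openHalfPlane, 0 ≤ K x ∧ K x ≤ Lam := fun x hx =>
    ⟨hlam.le.trans (hK x hx).1, (hK x hx).2⟩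
  rw [hnR] at hx hcon
  have hlin : ∀ t, 0 < t → t ≤ 4 * R → ∀ x : Plane, t / 2 ≤ x 1 →
      expMass v (square t x) ≤ 16 * t * (d * R) := fun t ht htR x hx =>
    expMass_square_le_linear hc hv0 (by omega) hθh H ht htR hx
  have hcell : ∀ p, expMass v (square R (cellCenter n R x p)) ≤ d * R ^ 2 := fun p =>
    H k le_rfl _ (half_le_of_square_subset hR0.le (cell_subset_closedHalfPlane hR0.le hx p))
  have htot : d * R ^ 2 * (n ^ 2 - 1 / 2) < expMass v (square (n * R) x) := by
    refine lt_of_eq_of_lt ?_ hcon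
    rw [← hθ2, pow_succ]
    ring
  -- rows at height at least `3 * R` keep the discs of radius `2 * R` inside the half plane
  have hrow : ∀ p ∈ (Finset.range n ×ˢ Finset.range n).filter (fun p => 3 ≤ p.2),
      ∫ y in square R (cellCenter n R x p), v y ≤
        2 / c * (16 * B + 64 * Lam) * (d * R ^ 4) := by
    intro p hp
    rw [Finset.mem_filter] at hp
    obtain ⟨z, hz, hvz⟩ := exists_le_inv_of_expMass hc hR0.le hd0
      (cell_subset_closedHalfPlane hR0.le hx p)
      (half_lt_expMass_cell hc hR0 (by omega) hx hcell htot hp.1)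
    refine integral_square_le hc hL.le hK' hv0 heq hc0 (fun s h1 h2 => (hcut s h1 h2).2) hB hR1
      hdR hd0 hlin hz ?_ hvz
    have h1 := (abs_le.1 (hz 1)).1
    rw [cellCenter_one] at h1
    have h2 : (3 : ℝ) * R ≤ p.2 * R := by
      have : (3 : ℝ) ≤ p.2 := by exact_mod_cast hp.2
      gcongr
    linarith
  set t : ℝ := (2 * m + 1) * R with ht
  have ht0 : 0 < t := by positivity
  have htx : t < x 1 := by
    rw [hnm] at hx
    nlinarith
  have hvball : ∫ y in Metric.ball x t, v y ≤
      n ^ 2 * (2 / c * (16 * B + 64 * Lam) * (d * R ^ 4)) := by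
    have hB0 : 0 ≤ B := (abs_nonneg _).trans (hB 0 le_rfl)
    calc ∫ y in Metric.ball x t, v y
        ≤ ∑ p ∈ (Finset.range n ×ˢ Finset.range n).filter (fun p => 3 ≤ p.2),
          ∫ y in square R (cellCenter n R x p), v y := by
          refine setIntegral_le_sum_of_subset_biUnion Metric.isOpen_ball.measurableSet
            (fun _ _ => (isCompact_square _ _).measurableSet)
            (fun p _ => (hc.mono (cell_subset_closedHalfPlane hR0.le hx p)).integrableOn_compact
              (isCompact_square _ _))
            (fun p _ y hy => hv0 y (cell_subset_closedHalfPlane hR0.le hx p hy)) fun y hy => ?_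
          have hyt : y ∈ square (2 * t) x :=
            mem_square_of_norm_sub_le (by simpa [dist_eq_norm] using (Metric.mem_ball.1 hy).le)
          have hyQ : y ∈ square (n * R) x := fun i => (hyt i).trans (by
            rw [hnm, ht]
            nlinarith)
          obtain ⟨p, hp, hyp⟩ := exists_cell hR0 (by omega) hyQ
          refine ⟨p, Finset.mem_filter.2 ⟨hp, ?_⟩, hyp⟩
          have h1 := (abs_le.1 (hyt 1)).1
          have h2 := (abs_le.1 (hyp 1)).2
          rw [cellCenter_one, hnm] at h2
          have h3 : (5 / 2 : ℝ) * R ≤ p.2 * R := by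
            rw [ht] at h1
            linarith
          have h4 : (2 : ℝ) < p.2 := by
            have := le_of_mul_le_mul_right h3 hR0
            linarith
          exact_mod_cast h4
      _ ≤ ∑ p ∈ (Finset.range n ×ˢ Finset.range n).filter (fun p => 3 ≤ p.2),
          2 / c * (16 * B + 64 * Lam) * (d * R ^ 4) := Finset.sum_le_sum hrow
      _ ≤ ∑ p ∈ Finset.range n ×ˢ Finset.range n,
          2 / c * (16 * B + 64 * Lam) * (d * R ^ 4) :=
          Finset.sum_le_sum_of_subset_of_nonneg (Finset.filter_subset _ _)
            fun _ _ _ => by positivity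
      _ = _ := by
          rw [Finset.sum_const, Finset.card_product, Finset.card_range, nsmul_eq_mul, Nat.cast_mul,
            ← sq]
  have h1 := le_integral_cutoff hc hlam hc0 hKm hK (fun s h1 h2 => (hcut s h1 h2).1) ht0 htx
  have h2 := integral_cutoffLaplacian_le hc hv0 hD ht0 htx
  rw [heq.integral_cutoff ht0 htx] at h2
  have h3 := expMass_inner_ge hc hR0 hx hcell (by positivity) htot
  have hD0 : 0 ≤ D := (abs_nonneg _).trans (hD 0 le_rfl)
  have hC0 : 0 ≤ 2 / c * (16 * B + 64 * Lam) := by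
    have hB0 : 0 ≤ B := (abs_nonneg _).trans (hB 0 le_rfl)
    positivity
  have hn81 : (n : ℝ) ^ 2 ≤ 81 * (2 * m + 1) ^ 2 := by
    rw [hnm]
    nlinarith
  have hfinal : lam * c * (d * R ^ 2 * (2 * m + 1) ^ 2 / 2) ≤
      D * 81 * (2 / c * (16 * B + 64 * Lam)) * (d * R ^ 2) := by
    calc lam * c * (d * R ^ 2 * (2 * m + 1) ^ 2 / 2)
        ≤ lam * c * expMass v (square t x) := by gcongr
      _ ≤ D / t ^ 2 * ∫ y in Metric.ball x t, v y := h1.trans h2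
      _ ≤ D / t ^ 2 * (n ^ 2 * (2 / c * (16 * B + 64 * Lam) * (d * R ^ 4))) := by gcongr
      _ ≤ D / t ^ 2 * (81 * (2 * m + 1) ^ 2 * (2 / c * (16 * B + 64 * Lam) * (d * R ^ 4))) := by
          gcongr
      _ = _ := by
          rw [ht]
          field_simp
  have hpos : 0 < d * R ^ 2 := by positivity
  have := mul_lt_mul_of_pos_right hbig hpos
  linarith

end

theorem mainTheorem5 (lam Lam kap : ℝ) (hlam : 0 < lam) :
    ∃ N : ℕ, Odd N ∧ 3 ≤ N ∧
      ∀ K v : Plane → ℝ, IsPinchedSolution lam Lam kap K v →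
        ∀ k : ℕ, globalDensity v ((N : ℝ) ^ k) ≤
          ENNReal.ofReal ((1 - 1 / (2 * (N : ℝ) ^ 2)) ^ k) := by
  obtain ⟨c, hc0, hcut⟩ := exists_cutoff_lower_bound
  obtain ⟨B, -, hB⟩ := exists_bound_of_vanishing contDiff_deriv_cutoffProfile.continuous
    fun _ => deriv_cutoffProfile_eq_zero
  obtain ⟨D, -, hD⟩ := exists_bound_of_vanishing continuous_cutoffLaplacian
    fun _ => cutoffLaplacian_eq_zero
  obtain ⟨m, hm⟩ := exists_nat_gt (D * 81 * (2 / c * (16 * B + 64 * Lam)) / (lam * c / 2))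
  rw [div_lt_iff₀ (by positivity)] at hm
  have hbig : D * 81 * (2 / c * (16 * B + 64 * Lam)) < lam * c / 2 * (2 * m + 1) ^ 2 := by
    have hm0 : (0 : ℝ) ≤ m := by positivity
    have h1 : (m : ℝ) ≤ (2 * m + 1) ^ 2 := by nlinarith
    have h2 : 0 < lam * c / 2 := by positivity
    nlinarith
  refine ⟨4 * m + 9, ⟨2 * m + 4, by ring⟩, by omega, fun K v hv k => ?_⟩
  have hc : ContinuousOn v closedHalfPlane := hv.contDiffOn.continuousOn
  have hv0 := nonneg_on_closedHalfPlane hc hv.nonneg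
  have hN : (0 : ℝ) < ((4 * m + 9 : ℕ) : ℝ) := by positivity
  have hθ : (0 : ℝ) ≤ 1 - 1 / (2 * ((4 * m + 9 : ℕ) : ℝ) ^ 2) := by
    have h1 : (1 : ℝ) ≤ ((4 * m + 9 : ℕ) : ℝ) := by exact_mod_cast (by omega : 1 ≤ 4 * m + 9)
    rw [sub_nonneg, div_le_one (by positivity)]
    nlinarith
  rw [globalDensity_le_iff hc (by positivity) (by positivity)]
  induction k using Nat.strong_induction_on with
  | _ k ih =>
    intro x hx
    rcases k with _ | k
    · simpa using expMass_square_le_sq hc hv0 zero_le_one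
        (square_subset_closedHalfPlane (by simpa using hx))
    · exact expMass_square_pow_succ_le hc hlam hv.measurable_K hv.pinched hv0 hv.equation hc0 hcut
        hB hD hbig rfl (fun j hj => ih j (Nat.lt_succ_of_le hj)) hx
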